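/- Let $\mathbb{H}$ be the real quaternions with units $\boldsymbol i,\boldsymbol j,\boldsymbol k$, put $e^{\boldsymbol j\theta}=\cos\theta+\boldsymbol j\sin\theta$ for $\theta\in\mathbb{R}$, and write $q^{*\boldsymbol j}=\overline{-\boldsymbol j q\boldsymbol j}$, that is, $(a+b\boldsymbol i+c\boldsymbol j+d\boldsymbol k)^{*\boldsymbol j}=a+b\boldsymbol i-c\boldsymbol j+d\boldsymbol k$. Let $f\in L^2(\mathbb{R},\mathbb{H})$ and let $g\in L^2(\mathbb{R},\mathbb{R})$ be symmetric ($g(-t)=g(t)$ for almost every $t$) with $\int_{\mathbb{R}} g(t)^2\,dt=1$. For $u,\xi\in\mathbb{R}$ put $$g_{u,\xi}(t)=e^{\boldsymbol j\xi t}g(t-u),\qquad Sf(u,\xi)=\int_{\mathbb{R}} f(t)\,g(t-u)\,e^{-\boldsymbol j\xi t}\,dt .$$ The integral defining $Sf(u,\xi)$ converges absolutely for all $u,\xi$, and the following hold. (1) Inversion formula: $$f(t)=\frac1{2\pi}\int_{-\infty}^{+\infty}\int_{-\infty}^{+\infty} Sf(u,\xi)\,g_{u,\xi}(t)\,d\xi\,du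 ,$$ in each of the following senses. (1a) If $K_1,K_2,\dots\subseteq\mathbb{R}^2$ are measurable sets of finite area such that almost every point of $\mathbb{R}^2$ belongs to $K_n$ for all sufficiently large $n$, then for each $n$ the integral $f_n(t)=\frac1{2\pi}\iint_{K_n}Sf(u,\xi)g_{u,\xi}(t)\,du\,d\xi$ converges absolutely for almost every $t$, $f_n\in L^2(\mathbb{R},\mathbb{H})$, and $\|f-f_n\|_{L^2}\to0$. (1b) For all $R>0$ the integral $F_R(t)=\frac1{2\pi}\int_{-\infty}^{+\infty}\int_{-R}^{R}Sf(u,\xi)g_{u,\xi}(t)\,d\xi\,du$ converges absolutely as a double integral for every $t$, $F_R\in L^2(\mathbb{R},\mathbb{H})$, and $\|f-F_R\|_{L^2}\to0$ as $R\to\infty$. (1c) The formula holds pointwise for almost every $t$ for which $(u,\xi)\mapsto Sf(u,\xi)g_{u,\xi}(t)$ is integrable on $\mathbb{R}^2$. (2) Conservation of energy: $|Sf|^2$ is integrable on $\mathbb{R}^2$ and $$\int_{-\infty}^{+\infty}|f(t)|^2\,dt=\frac1{2\pi}\int_{-\infty}^{+\infty}\int_{-\infty}^{+\infty}|Sf(u,\xi)|^2\,du\,d\xi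 .$$ (3) Conservation of polarization: $f f^{*\boldsymbol j}$ is integrable on $\mathbb{R}$, $Sf\,(Sf)^{*\boldsymbol j}$ is integrable on $\mathbb{R}^2$, and $$\int_{-\infty}^{+\infty}f(t)\,f(t)^{*\boldsymbol j}\,dt=\frac1{2\pi}\int_{-\infty}^{+\infty}\int_{-\infty}^{+\infty}Sf(u,\xi)\,Sf(u,\xi)^{*\boldsymbol j}\,du\,d\xi .$$ -/

import Mathlib

open MeasureTheory Filter Topology
open scoped Quaternion Real

noncomputable section

namespace QSTFT

/-- The quaternion unit `j`. -/
def qj : ℍ := ⟨0, 0, 1, 0⟩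

/-- The exponential `e^{jθ} = cos θ + j sin θ`, for real `θ`. -/
def expJ (θ : ℝ) : ℍ := ⟨Real.cos θ, 0, Real.sin θ, 0⟩

@[simp] theorem qj_re : qj.re = 0 := rfl
@[simp] theorem qj_imI : qj.imI = 0 := rfl
@[simp] theorem qj_imJ : qj.imJ = 1 := rfl
@[simp] theorem qj_imK : qj.imK = 0 := rfl
@[simp] theorem expJ_re (θ : ℝ) : (expJ θ).re = Real.cos θ := rfl
@[simp] theorem expJ_imI (θ : ℝ) : (expJ θ).imI = 0 := rfl
@[simp] theorem expJ_imJ (θ : ℝ) : (expJ θ).imJ = Real.sin θ := rfl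
@[simp] theorem expJ_imK (θ : ℝ) : (expJ θ).imK = 0 := rfl

/-- `expJ θ` is the exponential of the quaternion `θ j`. -/
theorem expJ_eq_exp (θ : ℝ) : expJ θ = NormedSpace.exp (θ • qj) := by
  have hre : (θ • qj).re = 0 := by simp
  rw [Quaternion.exp_of_re_eq_zero _ hre]
  have hn : ‖θ • qj‖ = |θ| := by
    rw [norm_smul, Real.norm_eq_abs]
    have h1 : ‖qj‖ * ‖qj‖ = 1 := by
      rw [← Quaternion.normSq_eq_norm_mul_self, Quaternion.normSq_def']
      simp
    have h2 : ‖qj‖ = 1 := by nlinarith [norm_nonneg qj]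
    rw [h2, mul_one]
  rw [hn, Real.cos_abs]
  rcases eq_or_ne θ 0 with h | h
  · subst h
    ext <;> simp
  · have h3 : Real.sin |θ| / |θ| * θ = Real.sin θ := by
      rcases abs_choice θ with h4 | h4 <;> rw [h4]
      · field_simp
      · rw [Real.sin_neg]; field_simp
    ext <;> simp [h3]

/-- Conjugation combined with the involution `q ↦ -j q j`. -/
def involJ (q : ℍ) : ℍ := star (-(qj * q * qj))

theorem involJ_eq (q : ℍ) : involJ q = ⟨q.re, q.imI, -q.imJ, q.imK⟩ := by
  apply Quaternion.ext
  · change _ = q.re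
    simp [involJ]
  · change _ = q.imI
    simp [involJ]
  · change _ = -q.imJ
    simp [involJ]
  · change _ = q.imK
    simp [involJ]

/-- The time-frequency-polarization atom `g_{u,ξ}(t) = e^{jξt} g(t - u)` of a real window `g`. -/
def atom (g : ℝ → ℝ) (u ξ t : ℝ) : ℍ := expJ (ξ * t) * (g (t - u) : ℍ)

/-- The quaternion short-term Fourier transform
`Sf(u, ξ) = ∫ f(t) g(t - u) e^{-jξt} dt`, exponential on the right. -/
def qstft (g : ℝ → ℝ) (f : ℝ → ℍ) (u ξ : ℝ) : ℍ :=
  ∫ t, f t * (g (t - u) : ℍ) * expJ (-(ξ * t))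

/-- `Sf(u, ξ)` is the quaternion inner product `⟨f, g_{u,ξ}⟩ = ∫ f(t) conj(g_{u,ξ}(t)) dt`. -/
theorem qstft_eq_inner (g : ℝ → ℝ) (f : ℝ → ℍ) (u ξ : ℝ) :
    qstft g f u ξ = ∫ t, f t * star (atom g u ξ t) := by
  have h : ∀ t, star (expJ t) = expJ (-t) := fun t => by ext <;> simp
  simp only [qstft, atom, star_mul, h, Quaternion.star_coe, mul_assoc]

end QSTFT

end

namespace QSTFT

open scoped FourierTransform SchwartzMap ENNReal RealInnerProductSpace


/-! ### Plancherel for complex functions, with kernel e^{-iξt} -/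

section Plancherel

/-! Write q = (a + cj) + i(b + dj). Right multiplication by e^{jθ} is then complex multiplication on
each bracket, so the transform splits into two complex Fourier transforms and Plancherel holds for
the right kernel e^{-jξt} (`lintegral_enorm_integral_expJ_sq`). Apply it in ξ to f·g(·-u) for fixed
u, then integrate in u: by Tonelli the window contributes ∫g² = 1, so ‖Sf‖² = 2π‖f‖²
(`lintegral_enorm_qstft_sq`).

Since S is additive, this polarizes to real inner products. S also commutes with left multiplication
by any quaternion, so the full quaternion ∫ f h̄ is preserved up to 2π (`integral_qstft_mul_star`).
The window is real and e^{-jξt} commutes with j, so S commutes with right multiplication by j as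
well. Taking h = -jfj gives conservation of polarization.

For inversion, Fubini shows that superposing the atoms over K is the adjoint of S cut off to K.
Hence 2πf minus the superposition pairs with h to ∫ ⟨Sh, Sf⟩ over the complement of K, and by
duality the L² error is at most a constant times the norm of Sf there
(`eLpNorm_two_pi_smul_sub_synthesis_le`). This tends to 0 because Sf ∈ L². Regions of finite area
and horizontal strips differ only in how absolute convergence is checked. -/

theorem integral_fourier_smul_eq_of_integrable {φ h : ℝ → ℂ} (hφ : Integrable φ)
    (hh : Integrable h) : ∫ x, 𝓕 φ x • h x = ∫ x, φ x • 𝓕 h x := by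
  simpa using! VectorFourier.integral_fourierIntegral_smul_eq_flip (L := innerₗ ℝ)
    Real.continuous_fourierChar continuous_inner hφ hh

theorem continuous_fourier_of_integrable {h : ℝ → ℂ} (hh : Integrable h) : Continuous (𝓕 h) :=
  VectorFourier.fourierIntegral_continuous Real.continuous_fourierChar
    (by exact continuous_inner) hh

/-- The `L²` Fourier transform is given by the Fourier integral on `L¹ ∩ L²`. -/
theorem fourier_toLp_ae_eq {h : ℝ → ℂ} (h1 : Integrable h) (h2 : MemLp h 2) :
    (𝓕 (h2.toLp h) : Lp (α := ℝ) ℂ 2) =ᵐ[volume] 𝓕 h := by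
  -- Both sides are compared against test functions ψ: the distributional transform moves 𝓕 onto ψ,
  -- and the multiplication formula moves it back onto the integrable h.
  refine ae_eq_of_integral_contDiff_smul_eq
    ((Lp.memLp _).locallyIntegrable (by norm_num))
    (continuous_fourier_of_integrable h1).locallyIntegrable fun ψ hψ hψs => ?_
  have hs : HasCompactSupport (fun x => (ψ x : ℂ)) := hψs.comp_left (g := Complex.ofReal) rfl
  let φ : 𝓢(ℝ, ℂ) := hs.toSchwartzMap (Complex.ofRealCLM.contDiff.comp hψ)
  have hφ : ∀ x, φ x = (ψ x : ℂ) := fun x => rfl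
  have e := DFunLike.congr_fun (Lp.fourier_toTemperedDistribution_eq (h2.toLp h)) φ
  rw [TemperedDistribution.fourier_apply, Lp.toTemperedDistribution_apply,
    Lp.toTemperedDistribution_apply] at e
  have e1 : ∫ x, (𝓕 φ) x • (h2.toLp h) x = ∫ x, (𝓕 φ) x • h x :=
    integral_congr_ae (by filter_upwards [h2.coeFn_toLp] with x hx; rw [hx])
  have e2 : ∫ x, (𝓕 φ) x • h x = ∫ x, φ x • 𝓕 h x := by
    rw [← integral_fourier_smul_eq_of_integrable φ.integrable h1]
    rfl
  rw [e1, e2] at e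
  simpa [hφ] using e.symm

theorem eLpNorm_two_sq {α E : Type*} [MeasurableSpace α] [NormedAddCommGroup E] (μ : Measure α)
    (h : α → E) : eLpNorm h 2 μ ^ 2 = ∫⁻ x, ‖h x‖ₑ ^ 2 ∂μ := by
  simpa using eLpNorm_nnreal_pow_eq_lintegral (f := h) (μ := μ) (p := 2) (by norm_num)

theorem lintegral_enorm_fourier_sq {h : ℝ → ℂ} (h1 : Integrable h) (h2 : MemLp h 2) :
    ∫⁻ w, ‖𝓕 h w‖ₑ ^ 2 = ∫⁻ t, ‖h t‖ₑ ^ 2 := by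
  rw [← eLpNorm_two_sq, ← eLpNorm_two_sq, ← eLpNorm_congr_ae (fourier_toLp_ae_eq h1 h2),
    ← Lp.enorm_def, ← eLpNorm_congr_ae h2.coeFn_toLp, ← Lp.enorm_def, ← ofReal_norm,
    ← ofReal_norm, Lp.norm_fourier_eq]

theorem lintegral_comp_mul_left {a : ℝ} (ha : a ≠ 0) (F : ℝ → ℝ≥0∞) :
    ∫⁻ x, F (a * x) = ENNReal.ofReal |a⁻¹| * ∫⁻ x, F x := by
  rw [← (measurableEmbedding_mulLeft₀ ha).lintegral_map F, Real.map_volume_mul_left ha,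
    lintegral_smul_measure, smul_eq_mul]

theorem lintegral_enorm_integral_exp_sq {h : ℝ → ℂ} (h1 : Integrable h) (h2 : MemLp h 2) :
    ∫⁻ ξ : ℝ, ‖∫ t, h t * Complex.exp ((-(ξ * t) : ℝ) * Complex.I)‖ₑ ^ 2 =
      ENNReal.ofReal (2 * π) * ∫⁻ t, ‖h t‖ₑ ^ 2 := by
  have hpi : (2 * π)⁻¹ ≠ 0 := by positivity
  -- The transform 𝓕 has kernel e^{-2πiwt}; substituting w = ξ/(2π) produces the factor 2π.
  have key := lintegral_comp_mul_left hpi (fun w => ‖𝓕 h w‖ₑ ^ 2)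
  rw [lintegral_enorm_fourier_sq h1 h2, inv_inv, abs_of_pos (by positivity)] at key
  rw [← key]
  refine lintegral_congr fun ξ => ?_
  rw [Real.fourier_real_eq_integral_exp_smul]
  congr 3
  ext t
  rw [smul_eq_mul, mul_comm]
  congr 4
  field_simp

end Plancherel

/-! ### Splitting ℍ into two complex lines; Plancherel for e^{-jξt} -/

section Components

/-- The component `a + c I` of `a + b i + c j + d k`. -/
noncomputable def fstComp : ℍ →L[ℝ] ℂ :=
  LinearMap.toContinuousLinearMap
    { toFun := fun q => ⟨q.re, q.imJ⟩
      map_add' := fun p q => by apply Complex.ext <;> simp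
      map_smul' := fun r q => by apply Complex.ext <;> simp }

/-- The component `b + d I` of `a + b i + c j + d k`. -/
noncomputable def sndComp : ℍ →L[ℝ] ℂ :=
  LinearMap.toContinuousLinearMap
    { toFun := fun q => ⟨q.imI, q.imK⟩
      map_add' := fun p q => by apply Complex.ext <;> simp
      map_smul' := fun r q => by apply Complex.ext <;> simp }

theorem fstComp_apply (q : ℍ) : fstComp q = ⟨q.re, q.imJ⟩ := rfl

theorem sndComp_apply (q : ℍ) : sndComp q = ⟨q.imI, q.imK⟩ := rfl

/-- The brackets in q = (a + cj) + i(b + dj) lie in ℝ + ℝj ≅ ℂ, which contains e^{jθ}, and i stands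
on the left, out of the way of a right factor. -/
theorem fstComp_mul_expJ (q : ℍ) (θ : ℝ) :
    fstComp (q * expJ θ) = fstComp q * Complex.exp (θ * Complex.I) := by
  rw [fstComp_apply, fstComp_apply]
  apply Complex.ext <;> simp [Complex.exp_ofReal_mul_I_re, Complex.exp_ofReal_mul_I_im]

theorem sndComp_mul_expJ (q : ℍ) (θ : ℝ) :
    sndComp (q * expJ θ) = sndComp q * Complex.exp (θ * Complex.I) := by
  rw [sndComp_apply, sndComp_apply]
  apply Complex.ext <;> simp [Complex.exp_ofReal_mul_I_re, Complex.exp_ofReal_mul_I_im]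

theorem enorm_sq_eq_components (q : ℍ) : ‖q‖ₑ ^ 2 = ‖fstComp q‖ₑ ^ 2 + ‖sndComp q‖ₑ ^ 2 := by
  have h : ‖q‖ ^ 2 = ‖fstComp q‖ ^ 2 + ‖sndComp q‖ ^ 2 := by
    rw [sq ‖q‖, ← Quaternion.normSq_eq_norm_mul_self, Quaternion.normSq_def',
      ← Complex.normSq_eq_norm_sq, ← Complex.normSq_eq_norm_sq, fstComp_apply, sndComp_apply,
      Complex.normSq_mk, Complex.normSq_mk]
    ring
  simp only [← ofReal_norm]
  rw [← ENNReal.ofReal_pow (norm_nonneg _), ← ENNReal.ofReal_pow (norm_nonneg _),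
    ← ENNReal.ofReal_pow (norm_nonneg _), h, ENNReal.ofReal_add (by positivity) (by positivity)]

theorem norm_expJ (θ : ℝ) : ‖expJ θ‖ = 1 := by
  have h : ‖expJ θ‖ * ‖expJ θ‖ = 1 := by
    rw [← Quaternion.normSq_eq_norm_mul_self, Quaternion.normSq_def']
    simp
  nlinarith [norm_nonneg (expJ θ)]

theorem enorm_expJ (θ : ℝ) : ‖expJ θ‖ₑ = 1 := by
  rw [← ofReal_norm, norm_expJ, ENNReal.ofReal_one]

theorem continuous_expJ : Continuous expJ := by
  have h : expJ = fun θ => Real.cos θ • (1 : ℍ) + Real.sin θ • qj := by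
    ext θ <;> simp
  rw [h]
  fun_prop

theorem integrable_mul_expJ {h : ℝ → ℍ} (h1 : Integrable h) (ξ : ℝ) :
    Integrable (fun t => h t * expJ (-(ξ * t))) := by
  refine h1.mono (h1.1.mul (continuous_expJ.comp (by fun_prop)).aestronglyMeasurable)
    (ae_of_all _ fun t => ?_)
  rw [norm_mul, norm_expJ, mul_one]

/-- Plancherel's theorem for the Fourier transform with the right kernel `e^{-jξt}`. -/
theorem lintegral_enorm_integral_expJ_sq {h : ℝ → ℍ} (h1 : Integrable h) (h2 : MemLp h 2) :
    ∫⁻ ξ : ℝ, ‖∫ t, h t * expJ (-(ξ * t))‖ₑ ^ 2 =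
      ENNReal.ofReal (2 * π) * ∫⁻ t, ‖h t‖ₑ ^ 2 := by
  have hm : AEMeasurable (fun t => ‖fstComp (h t)‖ₑ ^ 2) volume :=
    (fstComp.continuous.comp_aestronglyMeasurable h1.1).enorm.pow_const 2
  have hc : Continuous
      (fun ξ : ℝ => ∫ t, fstComp (h t) * Complex.exp ((-(ξ * t) : ℝ) * Complex.I)) := by
    refine continuous_of_dominated (bound := fun t => ‖fstComp (h t)‖) (fun ξ => ?_)
      (fun ξ => ae_of_all _ fun t => ?_) (fstComp.integrable_comp h1).norm
      (ae_of_all _ fun t => by fun_prop)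
    · exact (fstComp.integrable_comp h1).1.mul
        (Continuous.aestronglyMeasurable (by fun_prop))
    · rw [norm_mul, Complex.norm_exp_ofReal_mul_I, mul_one]
  simp_rw [enorm_sq_eq_components]
  rw [lintegral_add_left' hm, mul_add,
    ← lintegral_enorm_integral_exp_sq (fstComp.integrable_comp h1) (fstComp.comp_memLp' h2),
    ← lintegral_enorm_integral_exp_sq (sndComp.integrable_comp h1) (sndComp.comp_memLp' h2),
    ← lintegral_add_left (hc.enorm.measurable.pow_const 2)]
  refine lintegral_congr fun ξ => ?_
  rw [← fstComp.integral_comp_comm (integrable_mul_expJ h1 ξ),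
    ← sndComp.integral_comp_comm (integrable_mul_expJ h1 ξ)]
  simp only [fstComp_mul_expJ, sndComp_mul_expJ]

end Components


/-! ### Conservation of energy -/

section Energy

variable {f h : ℝ → ℍ} {g : ℝ → ℝ}

theorem memLp_coe {α : Type*} [MeasurableSpace α] {μ : Measure α} {g : α → ℝ}
    (hg : MemLp g 2 μ) : MemLp (fun t => (g t : ℍ)) 2 μ :=
  hg.of_le (Quaternion.continuous_coe.comp_aestronglyMeasurable hg.1)
    (ae_of_all _ fun _ => (Quaternion.norm_coe _).le)

theorem memLp_translate (hg : MemLp g 2) (u : ℝ) : MemLp (fun t => (g (t - u) : ℍ)) 2 :=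
  (memLp_coe hg).comp_measurePreserving (measurePreserving_sub_right volume u)

theorem integrable_mul_window (hf : MemLp f 2) (hg : MemLp g 2) (u : ℝ) :
    Integrable (fun t => f t * (g (t - u) : ℍ)) :=
  hf.integrable_mul (memLp_translate hg u)

theorem integrable_qstft_integrand (hf : MemLp f 2) (hg : MemLp g 2) (u ξ : ℝ) :
    Integrable (fun t => f t * (g (t - u) : ℍ) * expJ (-(ξ * t))) :=
  integrable_mul_expJ (integrable_mul_window hf hg u) ξ

theorem aestronglyMeasurable_window (hg : AEStronglyMeasurable g volume) :
    AEStronglyMeasurable (fun z : ℝ × ℝ => (g (z.2 - z.1) : ℍ)) (volume.prod volume) := by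
  have h1 : AEStronglyMeasurable (fun z : ℝ × ℝ => (g (z.1 - z.2) : ℍ)) (volume.prod volume) :=
    (Quaternion.continuous_coe.comp_aestronglyMeasurable hg).comp_quasiMeasurePreserving
      (quasiMeasurePreserving_sub_of_right_invariant volume volume)
  exact h1.prod_swap

theorem aestronglyMeasurable_window_phase (hg : AEStronglyMeasurable g volume) :
    AEStronglyMeasurable (fun z : (ℝ × ℝ) × ℝ => (g (z.2 - z.1.1) : ℍ))
      ((volume : Measure (ℝ × ℝ)).prod volume) :=
  (Quaternion.continuous_coe.comp_aestronglyMeasurable hg).comp_quasiMeasurePreserving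
    (QuasiMeasurePreserving.prod_of_right (by fun_prop)
      (ae_of_all _ fun p => (measurePreserving_sub_right volume p.1).quasiMeasurePreserving))

theorem aestronglyMeasurable_qstft (hf : AEStronglyMeasurable f volume)
    (hg : AEStronglyMeasurable g volume) :
    AEStronglyMeasurable (fun p : ℝ × ℝ => qstft g f p.1 p.2) volume := by
  refine AEStronglyMeasurable.integral_prod_right'
    (f := fun z : (ℝ × ℝ) × ℝ => f z.2 * (g (z.2 - z.1.1) : ℍ) * expJ (-(z.1.2 * z.2))) ?_
  exact (hf.comp_snd.mul (aestronglyMeasurable_window_phase hg)).mul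
    (continuous_expJ.comp (by fun_prop)).aestronglyMeasurable

/-- After Tonelli, the u-integral at fixed t is |f(t)|² times the energy of the reflected and
translated window, which is 1. -/
theorem lintegral_enorm_mul_window_sq (hf : AEStronglyMeasurable f volume)
    (hg : AEStronglyMeasurable g volume) (hg1 : ∫⁻ t, ‖g t‖ₑ ^ 2 = 1) :
    ∫⁻ u, ∫⁻ t, ‖f t * (g (t - u) : ℍ)‖ₑ ^ 2 = ∫⁻ t, ‖f t‖ₑ ^ 2 := by
  rw [lintegral_lintegral_swap]
  · refine lintegral_congr fun t => ?_
    have hn : ∀ u, ‖f t * (g (t - u) : ℍ)‖ₑ ^ 2 = ‖f t‖ₑ ^ 2 * ‖g (t - u)‖ₑ ^ 2 := fun u => by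
      rw [enorm_mul, mul_pow, ← ofReal_norm (g (t - u) : ℍ), Quaternion.norm_coe, ofReal_norm]
    simp_rw [hn]
    rw [lintegral_const_mul' _ _ (by finiteness),
      lintegral_sub_left_eq_self (fun u => ‖g u‖ₑ ^ 2) t, hg1, mul_one]
  · exact (hf.comp_snd.mul (aestronglyMeasurable_window hg)).enorm.pow_const 2

theorem lintegral_enorm_sq_lt_top {α E : Type*} [MeasurableSpace α] [NormedAddCommGroup E]
    {μ : Measure α} {h : α → E} (hh : MemLp h 2 μ) : ∫⁻ x, ‖h x‖ₑ ^ 2 ∂μ < ∞ := by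
  rw [← eLpNorm_two_sq]
  exact ENNReal.pow_lt_top hh.2

theorem memLp_two_of_lintegral_enorm_sq {α E : Type*} [MeasurableSpace α] [NormedAddCommGroup E]
    {μ : Measure α} {h : α → E} (hm : AEStronglyMeasurable h μ)
    (hh : ∫⁻ x, ‖h x‖ₑ ^ 2 ∂μ < ∞) : MemLp h 2 μ := by
  refine ⟨hm, ?_⟩
  rw [← eLpNorm_two_sq] at hh
  by_contra hc
  rw [not_lt_top_iff] at hc
  simp [hc] at hh

theorem lintegral_enorm_qstft_sq (hf : MemLp f 2) (hg : MemLp g 2)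
    (hg1 : ∫⁻ t, ‖g t‖ₑ ^ 2 = 1) :
    ∫⁻ p : ℝ × ℝ, ‖qstft g f p.1 p.2‖ₑ ^ 2 = ENNReal.ofReal (2 * π) * ∫⁻ t, ‖f t‖ₑ ^ 2 := by
  have hfin := lintegral_enorm_mul_window_sq hf.1 hg.1 hg1
  -- Plancherel needs f·g(·-u) ∈ L². A product of two L² functions is only L¹ in general, but
  -- finiteness of the double integral gives L² for almost every u.
  have hae : ∀ᵐ u : ℝ, ∫⁻ t, ‖f t * (g (t - u) : ℍ)‖ₑ ^ 2 < ∞ := by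
    refine ae_lt_top' ?_ (hfin.trans_lt (lintegral_enorm_sq_lt_top hf)).ne
    exact ((hf.1.comp_snd.mul
      (aestronglyMeasurable_window hg.1)).enorm.pow_const 2).lintegral_prod_right'
  rw [Measure.volume_eq_prod, lintegral_prod _
    ((aestronglyMeasurable_qstft hf.1 hg.1).enorm.pow_const 2), ← hfin,
    ← lintegral_const_mul' _ _ ENNReal.ofReal_ne_top]
  refine lintegral_congr_ae ?_
  filter_upwards [hae] with u hu
  exact lintegral_enorm_integral_expJ_sq (integrable_mul_window hf hg u)
    (memLp_two_of_lintegral_enorm_sq (integrable_mul_window hf hg u).1 hu)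

theorem memLp_qstft (hf : MemLp f 2) (hg : MemLp g 2) (hg1 : ∫⁻ t, ‖g t‖ₑ ^ 2 = 1) :
    MemLp (fun p : ℝ × ℝ => qstft g f p.1 p.2) 2 := by
  refine memLp_two_of_lintegral_enorm_sq (aestronglyMeasurable_qstft hf.1 hg.1) ?_
  rw [lintegral_enorm_qstft_sq hf hg hg1]
  exact ENNReal.mul_lt_top ENNReal.ofReal_lt_top (lintegral_enorm_sq_lt_top hf)

theorem integral_norm_sq_eq_toReal {α E : Type*} [MeasurableSpace α] [NormedAddCommGroup E]
    {μ : Measure α} {h : α → E} (hh : AEStronglyMeasurable h μ) :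
    ∫ x, ‖h x‖ ^ 2 ∂μ = (∫⁻ x, ‖h x‖ₑ ^ 2 ∂μ).toReal := by
  rw [integral_eq_lintegral_of_nonneg_ae (ae_of_all _ fun x => by positivity) (by exact hh.norm.pow 2)]
  simp_rw [ENNReal.ofReal_pow (norm_nonneg _), ofReal_norm]

theorem integral_norm_qstft_sq (hf : MemLp f 2) (hg : MemLp g 2)
    (hg1 : ∫⁻ t, ‖g t‖ₑ ^ 2 = 1) :
    ∫ p : ℝ × ℝ, ‖qstft g f p.1 p.2‖ ^ 2 = 2 * π * ∫ t, ‖f t‖ ^ 2 := by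
  rw [integral_norm_sq_eq_toReal (aestronglyMeasurable_qstft hf.1 hg.1),
    integral_norm_sq_eq_toReal hf.1, lintegral_enorm_qstft_sq hf hg hg1, ENNReal.toReal_mul,
    ENNReal.toReal_ofReal (by positivity)]

end Energy

/-! ### Preservation of quaternion inner products and of polarization -/

section Polarization

variable {f h : ℝ → ℍ} {g : ℝ → ℝ}

theorem qstft_add (hf : MemLp f 2) (hh : MemLp h 2) (hg : MemLp g 2) (u ξ : ℝ) :
    qstft g (f + h) u ξ = qstft g f u ξ + qstft g h u ξ := by
  simp only [qstft, Pi.add_apply, add_mul]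
  exact integral_add (integrable_qstft_integrand hf hg u ξ) (integrable_qstft_integrand hh hg u ξ)

theorem qstft_sub (hf : MemLp f 2) (hh : MemLp h 2) (hg : MemLp g 2) (u ξ : ℝ) :
    qstft g (f - h) u ξ = qstft g f u ξ - qstft g h u ξ := by
  simp only [qstft, Pi.sub_apply, sub_mul]
  exact integral_sub (integrable_qstft_integrand hf hg u ξ) (integrable_qstft_integrand hh hg u ξ)

theorem qstft_const_mul (hf : MemLp f 2) (hg : MemLp g 2) (c : ℍ) (u ξ : ℝ) :
    qstft g (fun t => c * f t) u ξ = c * qstft g f u ξ := by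
  simp only [qstft, mul_assoc]
  refine integral_const_mul_of_integrable ?_
  simpa only [mul_assoc] using integrable_qstft_integrand hf hg u ξ

theorem qj_mul_coe_mul_expJ (r θ : ℝ) :
    (r : ℍ) * expJ θ * qj = qj * ((r : ℍ) * expJ θ) := by
  ext <;> simp

theorem qstft_mul_qj (hf : MemLp f 2) (hg : MemLp g 2) (u ξ : ℝ) :
    qstft g (fun t => f t * qj) u ξ = qstft g f u ξ * qj := by
  rw [qstft, qstft, ← integral_mul_const_of_integrable (integrable_qstft_integrand hf hg u ξ)]
  refine integral_congr_ae (ae_of_all _ fun t => ?_)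
  simp only [mul_assoc, ← qj_mul_coe_mul_expJ]

theorem memLp_const_mul (hf : MemLp f 2) (c : ℍ) : MemLp (fun t => c * f t) 2 :=
  (ContinuousLinearMap.mul ℝ ℍ c).comp_memLp' hf

theorem memLp_mul_const (hf : MemLp f 2) (c : ℍ) : MemLp (fun t => f t * c) 2 :=
  ((ContinuousLinearMap.mul ℝ ℍ).flip c).comp_memLp' hf

theorem integrable_inner_of_memLp {α : Type*} [MeasurableSpace α] {μ : Measure α} {f h : α → ℍ}
    (hf : MemLp f 2 μ) (hh : MemLp h 2 μ) : Integrable (fun x => ⟪f x, h x⟫) μ :=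
  (L2.integrable_inner (𝕜 := ℝ) (hf.toLp f) (hh.toLp h)).congr (by
    filter_upwards [hf.coeFn_toLp, hh.coeFn_toLp] with x h1 h2
    rw [h1, h2])

theorem integral_inner_eq_polarization {α : Type*} [MeasurableSpace α] {μ : Measure α}
    {f h : α → ℍ} (hf : MemLp f 2 μ) (hh : MemLp h 2 μ) :
    ∫ x, ⟪f x, h x⟫ ∂μ = (∫ x, ‖(f + h) x‖ ^ 2 ∂μ - ∫ x, ‖(f - h) x‖ ^ 2 ∂μ) / 4 := by
  rw [← integral_sub ((hf.add hh).integrable_norm_pow (by norm_num))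
    ((hf.sub hh).integrable_norm_pow (by norm_num)), ← integral_div]
  refine integral_congr_ae (ae_of_all _ fun x => ?_)
  simp only [Pi.add_apply, Pi.sub_apply]
  rw [norm_add_sq_real, norm_sub_sq_real]
  ring

theorem integral_inner_qstft (hf : MemLp f 2) (hh : MemLp h 2) (hg : MemLp g 2)
    (hg1 : ∫⁻ t, ‖g t‖ₑ ^ 2 = 1) :
    ∫ p : ℝ × ℝ, ⟪qstft g f p.1 p.2, qstft g h p.1 p.2⟫ = 2 * π * ∫ t, ⟪f t, h t⟫ := by
  rw [integral_inner_eq_polarization hf hh,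
    integral_inner_eq_polarization (memLp_qstft hf hg hg1) (memLp_qstft hh hg hg1)]
  simp only [Pi.add_apply, Pi.sub_apply, ← qstft_add hf hh hg, ← qstft_sub hf hh hg]
  rw [integral_norm_qstft_sq (hf.add hh) hg hg1, integral_norm_qstft_sq (hf.sub hh) hg hg1]
  simp only [Pi.add_apply, Pi.sub_apply]
  ring

theorem integrable_mul_star {α : Type*} [MeasurableSpace α] {μ : Measure α} {f h : α → ℍ}
    (hf : MemLp f 2 μ) (hh : MemLp h 2 μ) : Integrable (fun x => f x * star (h x)) μ :=
  hf.integrable_mul hh.star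

theorem inner_mul_star (c a b : ℍ) : ⟪c, a * star b⟫ = ⟪c * b, a⟫ := by
  rw [Quaternion.inner_def, Quaternion.inner_def, star_mul, star_star, mul_assoc]

/-- A quaternion is determined by its real inner products with all c, and ⟨c, f h̄⟩ = ⟨c h, f⟩. Left
linearity of S moves c inside the transform, which reduces the claim to the real identity. -/
theorem integral_qstft_mul_star (hf : MemLp f 2) (hh : MemLp h 2) (hg : MemLp g 2)
    (hg1 : ∫⁻ t, ‖g t‖ₑ ^ 2 = 1) :
    ∫ p : ℝ × ℝ, qstft g f p.1 p.2 * star (qstft g h p.1 p.2) =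
      (2 * π) • ∫ t, f t * star (h t) := by
  refine ext_inner_left ℝ fun c => ?_
  rw [inner_smul_right, ← integral_inner (integrable_mul_star hf hh), ← integral_inner
    (integrable_mul_star (memLp_qstft hf hg hg1) (memLp_qstft hh hg hg1))]
  simp only [inner_mul_star, ← qstft_const_mul hh hg]
  exact integral_inner_qstft (memLp_const_mul hh c) hf hg hg1

theorem qstft_conj_qj (hf : MemLp f 2) (hg : MemLp g 2) (u ξ : ℝ) :
    qstft g (fun t => -qj * (f t * qj)) u ξ = -(qj * qstft g f u ξ * qj) := by
  rw [qstft_const_mul (memLp_mul_const hf qj) hg, qstft_mul_qj hf hg, neg_mul, mul_assoc]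

theorem integral_qstft_mul_involJ (hf : MemLp f 2) (hg : MemLp g 2)
    (hg1 : ∫⁻ t, ‖g t‖ₑ ^ 2 = 1) :
    ∫ p : ℝ × ℝ, qstft g f p.1 p.2 * involJ (qstft g f p.1 p.2) =
      (2 * π) • ∫ t, f t * involJ (f t) := by
  -- The second function is -j f j, whose transform is -j (Sf) j.
  have key := integral_qstft_mul_star hf (memLp_const_mul (memLp_mul_const hf qj) (-qj)) hg hg1
  simp only [qstft_conj_qj hf hg] at key
  simpa only [involJ, neg_mul, mul_assoc] using key

theorem integrable_mul_involJ {α : Type*} [MeasurableSpace α] {μ : Measure α} {f : α → ℍ}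
    (hf : MemLp f 2 μ) : Integrable (fun x => f x * involJ (f x)) μ := by
  have h : MemLp (fun x => -(qj * f x * qj)) 2 μ :=
    ((-((ContinuousLinearMap.mul ℝ ℍ).flip qj).comp (ContinuousLinearMap.mul ℝ ℍ qj))).comp_memLp' hf
  exact integrable_mul_star hf h

end Polarization


/-! ### Duality in L² and vanishing tails -/

section Duality

variable {α E F : Type*} [MeasurableSpace α] [NormedAddCommGroup E] [NormedAddCommGroup F]
  {μ : Measure α}

theorem lintegral_enorm_mul_enorm_le {a : α → E} {b : α → F} (ha : AEStronglyMeasurable a μ)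
    (hb : AEStronglyMeasurable b μ) :
    ∫⁻ x, ‖a x‖ₑ * ‖b x‖ₑ ∂μ ≤ eLpNorm a 2 μ * eLpNorm b 2 μ := by
  have h := ENNReal.lintegral_mul_le_Lp_mul_Lq μ Real.HolderConjugate.two_two ha.enorm hb.enorm
  simpa [eLpNorm_eq_lintegral_rpow_enorm_toReal] using h

theorem enorm_inner_le [InnerProductSpace ℝ E] (a b : E) : ‖⟪a, b⟫‖ₑ ≤ ‖a‖ₑ * ‖b‖ₑ := by
  rw [← ofReal_norm, ← ofReal_norm, ← ofReal_norm, ← ENNReal.ofReal_mul (norm_nonneg _)]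
  exact ENNReal.ofReal_le_ofReal (norm_inner_le_norm a b)

theorem enorm_integral_inner_le [InnerProductSpace ℝ E] {a b : α → E}
    (ha : AEStronglyMeasurable a μ) (hb : AEStronglyMeasurable b μ) :
    ‖∫ x, ⟪a x, b x⟫ ∂μ‖ₑ ≤ eLpNorm a 2 μ * eLpNorm b 2 μ :=
  (enorm_integral_le_lintegral_enorm _).trans
    ((lintegral_mono fun x => enorm_inner_le (a x) (b x)).trans
      (lintegral_enorm_mul_enorm_le ha hb))

/-- The `L²` norm is controlled by the pairings with functions in `L¹ ∩ L²`. -/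
theorem eLpNorm_two_le_of_enorm_integral_inner_le [InnerProductSpace ℝ E] [SigmaFinite μ]
    {D : α → E} (hD : AEStronglyMeasurable D μ) {C : ℝ≥0∞}
    (hC : ∀ h : α → E, MemLp h 1 μ → MemLp h 2 μ →
      ‖∫ x, ⟪h x, D x⟫ ∂μ‖ₑ ≤ C * eLpNorm h 2 μ) :
    eLpNorm D 2 μ ≤ C := by
  obtain ⟨D', hD', hDD'⟩ := hD
  -- On these sets the measure is finite and D' is bounded, so the truncations of D' lie in every Lᵖ
  -- and are admissible test functions.
  let A : ℕ → Set α := fun n => spanningSets μ n ∩ {x | ‖D' x‖ ≤ n}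
  have hA : ∀ n, MeasurableSet (A n) := fun n =>
    (measurableSet_spanningSets μ n).inter (measurableSet_le hD'.norm.measurable measurable_const)
  have hmem : ∀ n (p : ℝ≥0∞), MemLp ((A n).indicator D') p μ := fun n p => by
    have : IsFiniteMeasure (μ.restrict (A n)) := ⟨by
      rw [Measure.restrict_apply_univ]
      exact (measure_mono Set.inter_subset_left).trans_lt (measure_spanningSets_lt_top μ n)⟩
    rw [memLp_indicator_iff_restrict (hA n)]
    refine MemLp.of_bound hD'.aestronglyMeasurable n ?_
    filter_upwards [ae_restrict_mem (hA n)] with x hx using hx.2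
  have hle : ∀ n, eLpNorm ((A n).indicator D') 2 μ ≤ C := fun n => by
    set N := eLpNorm ((A n).indicator D') 2 μ with hN
    have hNtop : N ≠ ⊤ := (hmem n 2).2.ne
    have h1 : ∫ x, ⟪(A n).indicator D' x, D x⟫ ∂μ = (N ^ 2).toReal := by
      rw [hN, eLpNorm_two_sq, ← integral_norm_sq_eq_toReal (hmem n 2).1]
      refine integral_congr_ae ?_
      filter_upwards [hDD'] with x hx
      by_cases hxA : x ∈ A n
      · simp [hxA, hx]
      · simp [hxA]
    -- Testing with the truncation itself gives N² ≤ C·N, and N can be cancelled because it is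
    -- finite.
    have h2 := hC _ (hmem n 1) (hmem n 2)
    rw [h1, Real.enorm_of_nonneg ENNReal.toReal_nonneg, ENNReal.ofReal_toReal (by finiteness),
      sq] at h2
    rcases eq_or_ne N 0 with h0 | h0
    · rw [h0]
      exact zero_le
    · exact (ENNReal.mul_le_mul_iff_left h0 hNtop).1 h2
  have hlim : ∀ x, Tendsto (fun n => (A n).indicator D' x) atTop (𝓝 (D' x)) := fun x => by
    refine tendsto_const_nhds.congr' ?_
    obtain ⟨m, hm⟩ := exists_nat_ge ‖D' x‖
    filter_upwards [eventually_ge_atTop m, eventually_ge_atTop (spanningSetsIndex μ x)]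
      with n h1 h2
    refine (Set.indicator_of_mem ?_ D').symm
    exact ⟨mem_spanningSets_of_index_le μ x h2, hm.trans (by exact_mod_cast h1)⟩
  rw [eLpNorm_congr_ae hDD']
  refine (Lp.eLpNorm_lim_le_liminf_eLpNorm (fun n => (hmem n 2).1) D' (ae_of_all _ hlim)).trans ?_
  exact (liminf_le_liminf (Eventually.of_forall hle)).trans (liminf_const C).le

theorem tendsto_eLpNorm_two_restrict_compl {ι : Type*} {l : Filter ι} [l.IsCountablyGenerated]
    {K : ι → Set α} (hK : AECover μ l K) {s : α → E} (hs : MemLp s 2 μ) :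
    Tendsto (fun i => eLpNorm s 2 (μ.restrict (K i)ᶜ)) l (𝓝 0) := by
  have hfin := lintegral_enorm_sq_lt_top hs
  have h1 : Tendsto (fun i => ∫⁻ x in (K i)ᶜ, ‖s x‖ₑ ^ 2 ∂μ) l (𝓝 0) := by
    have h2 := ENNReal.Tendsto.sub (tendsto_const_nhds (x := ∫⁻ x, ‖s x‖ₑ ^ 2 ∂μ) (f := l))
      (hK.lintegral_tendsto_of_countably_generated (hs.1.enorm.pow_const 2)) (Or.inl hfin.ne)
    rw [tsub_self] at h2
    refine h2.congr fun i => ?_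
    rw [← lintegral_add_compl (fun x => ‖s x‖ₑ ^ 2) (hK.measurableSet i)]
    exact ENNReal.add_sub_cancel_left
      ((setLIntegral_le_lintegral _ _).trans_lt hfin).ne
  have h3 := (ENNReal.continuous_rpow_const (y := 1 / 2)).tendsto (0 : ℝ≥0∞) |>.comp h1
  rw [ENNReal.zero_rpow_of_pos (by norm_num)] at h3
  refine h3.congr fun i => ?_
  simp only [Function.comp]
  rw [← eLpNorm_two_sq, ← ENNReal.rpow_natCast, ← ENNReal.rpow_mul]
  norm_num

end Duality

/-! ### Superposition of atoms as a truncated adjoint -/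

section Synthesis

variable {f h : ℝ → ℍ} {g : ℝ → ℝ} {K : Set (ℝ × ℝ)}

/-- The superposition of the atoms over the region `K` of the time-frequency plane. -/
noncomputable def synthesis (g : ℝ → ℝ) (f : ℝ → ℍ) (K : Set (ℝ × ℝ)) (t : ℝ) : ℍ :=
  ∫ p in K, qstft g f p.1 p.2 * atom g p.1 p.2 t

/-- The integral of the norms of the terms of `synthesis`. -/
noncomputable def synthesisNorm (g : ℝ → ℝ) (f : ℝ → ℍ) (K : Set (ℝ × ℝ)) (t : ℝ) : ℝ≥0∞ :=
  ∫⁻ p in K, ‖qstft g f p.1 p.2 * atom g p.1 p.2 t‖ₑ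

theorem enorm_mul_atom (q : ℍ) (u ξ t : ℝ) : ‖q * atom g u ξ t‖ₑ = ‖q‖ₑ * ‖g (t - u)‖ₑ := by
  rw [atom, enorm_mul, enorm_mul, enorm_expJ, one_mul, ← ofReal_norm (g (t - u) : ℍ),
    Quaternion.norm_coe, ofReal_norm]

theorem mul_star_atom (q : ℍ) (u ξ t : ℝ) :
    q * star (atom g u ξ t) = q * (g (t - u) : ℍ) * expJ (-(ξ * t)) := by
  have hs : star (expJ (ξ * t)) = expJ (-(ξ * t)) := by ext <;> simp
  rw [atom, star_mul, hs, Quaternion.star_coe, mul_assoc]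

theorem aestronglyMeasurable_synthesis_integrand (hf : AEStronglyMeasurable f volume)
    (hg : AEStronglyMeasurable g volume) (K : Set (ℝ × ℝ)) :
    AEStronglyMeasurable
      (fun z : ℝ × (ℝ × ℝ) => qstft g f z.2.1 z.2.2 * atom g z.2.1 z.2.2 z.1)
      ((volume : Measure ℝ).prod (volume.restrict K)) := by
  have h1 : AEStronglyMeasurable
      (fun z : ℝ × (ℝ × ℝ) => qstft g f z.2.1 z.2.2 * atom g z.2.1 z.2.2 z.1)
      ((volume : Measure ℝ).prod volume) :=
    (aestronglyMeasurable_qstft hf hg).comp_snd.mul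
      ((continuous_expJ.comp (by fun_prop)).aestronglyMeasurable.mul
        (aestronglyMeasurable_window_phase hg).prod_swap)
  exact h1.mono_ac (Measure.AbsolutelyContinuous.rfl.prod Measure.restrict_le_self.absolutelyContinuous)

theorem aestronglyMeasurable_atom_section (hg : AEStronglyMeasurable g volume) (t : ℝ) :
    AEStronglyMeasurable (fun p : ℝ × ℝ => atom g p.1 p.2 t) volume := by
  have h1 : AEStronglyMeasurable (fun u : ℝ => (g (t - u) : ℍ)) volume :=
    (Quaternion.continuous_coe.comp_aestronglyMeasurable hg).comp_quasiMeasurePreserving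
      (quasiMeasurePreserving_sub_left_of_right_invariant volume t)
  exact (continuous_expJ.comp (by fun_prop)).aestronglyMeasurable.mul h1.comp_fst

theorem integrableOn_of_synthesisNorm_lt_top (hf : AEStronglyMeasurable f volume)
    (hg : AEStronglyMeasurable g volume) {t : ℝ} (ht : synthesisNorm g f K t < ⊤) :
    IntegrableOn (fun p : ℝ × ℝ => qstft g f p.1 p.2 * atom g p.1 p.2 t) K :=
  ⟨((aestronglyMeasurable_qstft hf hg).mul (aestronglyMeasurable_atom_section hg t)).restrict, ht⟩

theorem integrable_inner_synthesis_integrand (hf : AEStronglyMeasurable f volume)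
    (hg : AEStronglyMeasurable g volume) (hh : AEStronglyMeasurable h volume)
    (hfin : ∫⁻ t, ‖h t‖ₑ * synthesisNorm g f K t < ⊤) :
    Integrable
      (fun z : ℝ × (ℝ × ℝ) => ⟪h z.1, qstft g f z.2.1 z.2.2 * atom g z.2.1 z.2.2 z.1⟫)
      ((volume : Measure ℝ).prod (volume.restrict K)) := by
  have hm := aestronglyMeasurable_synthesis_integrand hf hg K
  refine ⟨hh.comp_fst.inner hm, ?_⟩
  refine (lintegral_mono fun z => enorm_inner_le _ _).trans_lt ?_
  rw [lintegral_prod _ (by exact hh.comp_fst.enorm.mul hm.enorm)]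
  refine (lintegral_mono fun t => ?_).trans_lt hfin
  exact (lintegral_const_mul' _ _ (by finiteness)).le

theorem integral_inner_synthesis_integrand (hh : MemLp h 2) (hg : MemLp g 2) (q : ℍ) (u ξ : ℝ) :
    ∫ t, ⟪h t, q * atom g u ξ t⟫ = ⟪qstft g h u ξ, q⟫ := by
  have hi : Integrable (fun t => h t * star (atom g u ξ t)) := by
    simpa only [mul_star_atom] using integrable_qstft_integrand hh hg u ξ
  rw [qstft_eq_inner, real_inner_comm, ← integral_inner hi]
  refine integral_congr_ae (ae_of_all _ fun t => ?_)
  simp only [Quaternion.inner_def, star_mul, star_star]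
  rw [← Quaternion.re_star]
  simp only [star_mul, star_star, mul_assoc]

theorem ae_integral_inner_eq_inner_synthesis (hf : AEStronglyMeasurable f volume)
    (hg : AEStronglyMeasurable g volume) (hK : ∀ᵐ t, synthesisNorm g f K t < ⊤) (h : ℝ → ℍ) :
    (fun t => ∫ p in K, ⟪h t, qstft g f p.1 p.2 * atom g p.1 p.2 t⟫) =ᵐ[volume]
      fun t => ⟪h t, synthesis g f K t⟫ := by
  filter_upwards [hK] with t ht
  exact integral_inner (integrableOn_of_synthesisNorm_lt_top hf hg ht) (h t)

theorem integrable_inner_synthesis (hf : AEStronglyMeasurable f volume)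
    (hg : AEStronglyMeasurable g volume) (hh : AEStronglyMeasurable h volume)
    (hK : ∀ᵐ t, synthesisNorm g f K t < ⊤)
    (hfin : ∫⁻ t, ‖h t‖ₑ * synthesisNorm g f K t < ⊤) :
    Integrable (fun t => ⟪h t, synthesis g f K t⟫) :=
  (integrable_inner_synthesis_integrand hf hg hh hfin).integral_prod_left.congr
    (ae_integral_inner_eq_inner_synthesis hf hg hK h)

theorem integral_inner_synthesis (hf : AEStronglyMeasurable f volume) (hg : MemLp g 2)
    (hh : MemLp h 2) (hK : ∀ᵐ t, synthesisNorm g f K t < ⊤)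
    (hfin : ∫⁻ t, ‖h t‖ₑ * synthesisNorm g f K t < ⊤) :
    ∫ t, ⟪h t, synthesis g f K t⟫ =
      ∫ p in K, ⟪qstft g h p.1 p.2, qstft g f p.1 p.2⟫ := by
  rw [← integral_congr_ae (ae_integral_inner_eq_inner_synthesis hf hg.1 hK h),
    integral_integral_swap (integrable_inner_synthesis_integrand hf hg.1 hh.1 hfin)]
  simp only [integral_inner_synthesis_integrand hh hg]

theorem eLpNorm_qstft (hf : MemLp f 2) (hg : MemLp g 2) (hg1 : ∫⁻ t, ‖g t‖ₑ ^ 2 = 1) :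
    eLpNorm (fun p : ℝ × ℝ => qstft g f p.1 p.2) 2 volume =
      ENNReal.ofReal √(2 * π) * eLpNorm f 2 volume := by
  refine (ENNReal.pow_right_strictMono (n := 2) two_ne_zero).injective ?_
  rw [mul_pow, ← ENNReal.ofReal_pow (by positivity), Real.sq_sqrt (by positivity),
    eLpNorm_two_sq, eLpNorm_two_sq, lintegral_enorm_qstft_sq hf hg hg1]

theorem aestronglyMeasurable_synthesis (hf : AEStronglyMeasurable f volume)
    (hg : AEStronglyMeasurable g volume) (K : Set (ℝ × ℝ)) :
    AEStronglyMeasurable (synthesis g f K) volume :=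
  (aestronglyMeasurable_synthesis_integrand hf hg K).integral_prod_right'

/-- By the isometry, 2π⟨h, f⟩ is the integral of ⟨Sh, Sf⟩ over the whole plane; the superposition
accounts for the part over K. Cauchy–Schwarz bounds the rest, with √(2π)‖h‖ as the norm of Sh. Tests
h ∈ L¹ ∩ L² suffice, so each kind of region may use whichever integrability it needs. -/
theorem eLpNorm_two_pi_smul_sub_synthesis_le (hf : MemLp f 2) (hg : MemLp g 2)
    (hg1 : ∫⁻ t, ‖g t‖ₑ ^ 2 = 1) (hKm : MeasurableSet K)
    (hK : ∀ᵐ t, synthesisNorm g f K t < ⊤)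
    (hKh : ∀ h : ℝ → ℍ, MemLp h 1 → MemLp h 2 → ∫⁻ t, ‖h t‖ₑ * synthesisNorm g f K t < ⊤) :
    eLpNorm (fun t => (2 * π) • f t - synthesis g f K t) 2 volume ≤
      ENNReal.ofReal √(2 * π) *
        eLpNorm (fun p : ℝ × ℝ => qstft g f p.1 p.2) 2 (volume.restrict Kᶜ) := by
  have hD : AEStronglyMeasurable (fun t => (2 * π) • f t - synthesis g f K t) volume :=
    (hf.1.const_smul (2 * π)).sub (aestronglyMeasurable_synthesis hf.1 hg.1 K)
  refine eLpNorm_two_le_of_enorm_integral_inner_le hD fun h h1 h2 => ?_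
  have hS := memLp_qstft hf hg hg1
  have hSh := memLp_qstft h2 hg hg1
  have hpair : ∫ t, ⟪h t, (2 * π) • f t - synthesis g f K t⟫ =
      ∫ p in Kᶜ, ⟪qstft g h p.1 p.2, qstft g f p.1 p.2⟫ := by
    simp only [inner_sub_right, inner_smul_right]
    rw [integral_sub ((integrable_inner_of_memLp h2 hf).const_mul _)
        (integrable_inner_synthesis hf.1 hg.1 h2.1 hK (hKh h h1 h2)),
      integral_const_mul, ← integral_inner_qstft h2 hf hg hg1,
      integral_inner_synthesis hf.1 hg h2 hK (hKh h h1 h2),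
      ← integral_add_compl hKm (integrable_inner_of_memLp hSh hS), add_sub_cancel_left]
  rw [hpair]
  refine (enorm_integral_inner_le hSh.1.restrict hS.1.restrict).trans ?_
  rw [mul_right_comm, ← eLpNorm_qstft h2 hg hg1]
  gcongr
  exact Measure.restrict_le_self

theorem eLpNorm_sub_synthesis_le (hf : MemLp f 2) (hg : MemLp g 2)
    (hg1 : ∫⁻ t, ‖g t‖ₑ ^ 2 = 1) (hKm : MeasurableSet K)
    (hK : ∀ᵐ t, synthesisNorm g f K t < ⊤)
    (hKh : ∀ h : ℝ → ℍ, MemLp h 1 → MemLp h 2 → ∫⁻ t, ‖h t‖ₑ * synthesisNorm g f K t < ⊤) :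
    eLpNorm (fun t => f t - (1 / (2 * π)) • synthesis g f K t) 2 volume ≤
      ‖1 / (2 * π)‖ₑ * (ENNReal.ofReal √(2 * π) *
        eLpNorm (fun p : ℝ × ℝ => qstft g f p.1 p.2) 2 (volume.restrict Kᶜ)) := by
  have he : (fun t => f t - (1 / (2 * π)) • synthesis g f K t) =
      (1 / (2 * π)) • fun t => (2 * π) • f t - synthesis g f K t := by
    ext1 t
    rw [Pi.smul_apply, smul_sub, smul_smul, one_div_mul_cancel (by positivity), one_smul]
  rw [he, eLpNorm_const_smul]
  gcongr
  exact eLpNorm_two_pi_smul_sub_synthesis_le hf hg hg1 hKm hK hKh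

theorem memLp_smul_synthesis (hf : MemLp f 2) (hg : MemLp g 2)
    (hg1 : ∫⁻ t, ‖g t‖ₑ ^ 2 = 1) (hKm : MeasurableSet K)
    (hK : ∀ᵐ t, synthesisNorm g f K t < ⊤)
    (hKh : ∀ h : ℝ → ℍ, MemLp h 1 → MemLp h 2 → ∫⁻ t, ‖h t‖ₑ * synthesisNorm g f K t < ⊤) :
    MemLp (fun t => (1 / (2 * π)) • synthesis g f K t) 2 := by
  have hd : MemLp (fun t => f t - (1 / (2 * π)) • synthesis g f K t) 2 := by
    refine ⟨hf.1.sub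
      ((aestronglyMeasurable_synthesis hf.1 hg.1 K).const_smul (1 / (2 * π))), ?_⟩
    refine (eLpNorm_sub_synthesis_le hf hg hg1 hKm hK hKh).trans_lt ?_
    have := ((memLp_qstft hf hg hg1).restrict Kᶜ).2
    finiteness
  exact (hf.sub hd).ae_eq (ae_of_all _ fun t => sub_sub_cancel _ _)

theorem tendsto_eLpNorm_sub_synthesis {ι : Type*} {l : Filter ι} [l.IsCountablyGenerated]
    {K : ι → Set (ℝ × ℝ)} (hf : MemLp f 2) (hg : MemLp g 2) (hg1 : ∫⁻ t, ‖g t‖ₑ ^ 2 = 1)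
    (hcov : AECover volume l K) (hK : ∀ i, ∀ᵐ t, synthesisNorm g f (K i) t < ⊤)
    (hKh : ∀ i, ∀ h : ℝ → ℍ, MemLp h 1 → MemLp h 2 →
      ∫⁻ t, ‖h t‖ₑ * synthesisNorm g f (K i) t < ⊤) :
    Tendsto (fun i => eLpNorm (fun t => f t - (1 / (2 * π)) • synthesis g f (K i) t) 2 volume)
      l (𝓝 0) := by
  have h0 := tendsto_eLpNorm_two_restrict_compl hcov (memLp_qstft hf hg hg1)
  have h1 := ENNReal.Tendsto.const_mul (a := ENNReal.ofReal √(2 * π)) h0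
    (Or.inr ENNReal.ofReal_ne_top)
  have h2 := ENNReal.Tendsto.const_mul (a := ‖1 / (2 * π)‖ₑ) h1 (Or.inr enorm_ne_top)
  simp only [mul_zero] at h2
  exact tendsto_of_tendsto_of_tendsto_of_le_of_le tendsto_const_nhds h2 (fun _ => zero_le)
    fun i => eLpNorm_sub_synthesis_le hf hg hg1 (hcov.measurableSet i) (hK i) (hKh i)

end Synthesis


/-! ### Absolute convergence over finite-area sets and strips; pointwise inversion -/

section Regions

variable {f h : ℝ → ℍ} {g : ℝ → ℝ} {K : Set (ℝ × ℝ)}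

theorem lintegral_enorm_sq_eq_one (hg : MemLp g 2) (hnorm : ∫ t, g t ^ 2 = 1) :
    ∫⁻ t, ‖g t‖ₑ ^ 2 = 1 := by
  have h := integral_norm_sq_eq_toReal hg.1
  simp only [Real.norm_eq_abs, sq_abs, hnorm] at h
  exact (ENNReal.toReal_eq_one_iff _).1 h.symm

theorem lintegral_enorm_mul_translate_le (hh : MemLp h 2) (hg : MemLp g 2) (u : ℝ) :
    ∫⁻ t, ‖h t‖ₑ * ‖g (t - u)‖ₑ ≤ eLpNorm h 2 volume * eLpNorm g 2 volume := by
  have hmp := measurePreserving_sub_right (volume : Measure ℝ) u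
  have he : eLpNorm (fun t => g (t - u)) 2 volume = eLpNorm g 2 volume :=
    eLpNorm_comp_measurePreserving hg.1 hmp
  rw [← he]
  exact lintegral_enorm_mul_enorm_le hh.1 (hg.1.comp_measurePreserving hmp)

/-- On a set of finite area Sf is integrable, and for each u Cauchy–Schwarz bounds ∫|h(t)||g(t-u)|dt
by ‖h‖‖g‖. Here h ∈ L² is what matters. -/
theorem lintegral_enorm_mul_synthesisNorm_lt_top (hf : MemLp f 2) (hg : MemLp g 2)
    (hg1 : ∫⁻ t, ‖g t‖ₑ ^ 2 = 1) (hKfin : volume K < ⊤) (hh : MemLp h 2) :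
    ∫⁻ t, ‖h t‖ₑ * synthesisNorm g f K t < ⊤ := by
  have : IsFiniteMeasure (volume.restrict K) := ⟨by rwa [Measure.restrict_apply_univ]⟩
  have hS : ∫⁻ p in K, ‖qstft g f p.1 p.2‖ₑ < ⊤ :=
    (((memLp_qstft hf hg hg1).restrict K).integrable (by norm_num)).2
  have h1 : ∀ t, ‖h t‖ₑ * synthesisNorm g f K t =
      ∫⁻ p in K, ‖h t‖ₑ * ‖qstft g f p.1 p.2 * atom g p.1 p.2 t‖ₑ := fun t =>
    (lintegral_const_mul' _ _ (by finiteness)).symm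
  simp_rw [h1]
  rw [lintegral_lintegral_swap (hh.1.comp_fst.enorm.mul
    (aestronglyMeasurable_synthesis_integrand hf.1 hg.1 K).enorm)]
  have h2 : ∀ p : ℝ × ℝ, ∫⁻ t, ‖h t‖ₑ * ‖qstft g f p.1 p.2 * atom g p.1 p.2 t‖ₑ ≤
      ‖qstft g f p.1 p.2‖ₑ * (eLpNorm h 2 volume * eLpNorm g 2 volume) := fun p => by
    have h3 : ∀ t, ‖h t‖ₑ * ‖qstft g f p.1 p.2 * atom g p.1 p.2 t‖ₑ =
        ‖qstft g f p.1 p.2‖ₑ * (‖h t‖ₑ * ‖g (t - p.1)‖ₑ) := fun t => by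
      rw [enorm_mul_atom, mul_left_comm]
    simp_rw [h3]
    rw [lintegral_const_mul' _ _ (by finiteness)]
    gcongr
    exact lintegral_enorm_mul_translate_le hh hg p.1
  refine (lintegral_mono h2).trans_lt ?_
  have := hh.2
  have := hg.2
  rw [lintegral_mul_const' _ _ (by finiteness)]
  finiteness

theorem memLp_inv_one_add_sq : MemLp (fun t : ℝ => (((1 + t ^ 2)⁻¹ : ℝ) : ℍ)) 2 := by
  refine memLp_coe ⟨integrable_inv_one_add_sq.1, ?_⟩
  have h1 : MemLp (fun t : ℝ => (1 + t ^ 2)⁻¹) 2 := by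
    refine memLp_two_of_lintegral_enorm_sq integrable_inv_one_add_sq.1
      ((lintegral_mono fun t => ?_).trans_lt integrable_inv_one_add_sq.2)
    refine pow_le_of_le_one zero_le ?_ two_ne_zero
    rw [← ofReal_norm, Real.norm_of_nonneg (by positivity)]
    exact ENNReal.ofReal_le_one.2 (inv_le_one_of_one_le₀ (by nlinarith))
  exact h1.2

theorem ae_synthesisNorm_lt_top (hf : MemLp f 2) (hg : MemLp g 2)
    (hg1 : ∫⁻ t, ‖g t‖ₑ ^ 2 = 1) (hKfin : volume K < ⊤) :
    ∀ᵐ t, synthesisNorm g f K t < ⊤ := by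
  have hm : AEMeasurable (synthesisNorm g f K) volume :=
    (aestronglyMeasurable_synthesis_integrand hf.1 hg.1 K).enorm.lintegral_prod_right'
  -- A strictly positive L² weight: finiteness of the weighted integral forces the other factor to
  -- be finite almost everywhere.
  have h1 := lintegral_enorm_mul_synthesisNorm_lt_top hf hg hg1 hKfin memLp_inv_one_add_sq
  filter_upwards [ae_lt_top' (memLp_inv_one_add_sq.1.enorm.mul hm) h1.ne] with t ht
  by_contra hc
  rw [not_lt_top_iff] at hc
  rw [Pi.mul_apply, hc, ENNReal.mul_top] at ht
  · exact lt_irrefl _ ht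
  · rw [enorm_ne_zero, Ne, ← Quaternion.coe_zero, Quaternion.coe_inj]
    positivity

theorem volume_eq_prod_restrict_strip (R : ℝ) :
    (volume : Measure (ℝ × ℝ)).restrict (Set.univ ×ˢ Set.Icc (-R) R) =
      (volume : Measure ℝ).prod (volume.restrict (Set.Icc (-R) R)) := by
  rw [Measure.volume_eq_prod, ← Measure.prod_restrict, Measure.restrict_univ]

/-- A uniform bound for the absolute convergence over a horizontal strip. -/
theorem synthesisNorm_strip_le (hf : MemLp f 2) (hg : MemLp g 2)
    (hg1 : ∫⁻ t, ‖g t‖ₑ ^ 2 = 1) (R t : ℝ) :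
    synthesisNorm g f (Set.univ ×ˢ Set.Icc (-R) R) t ≤
      eLpNorm (fun p : ℝ × ℝ => qstft g f p.1 p.2) 2 volume *
        volume (Set.Icc (-R) R) ^ (1 / 2 : ℝ) := by
  have hgt : AEStronglyMeasurable (fun p : ℝ × ℝ => g (t - p.1)) volume :=
    AEStronglyMeasurable.comp_fst (f := fun u : ℝ => g (t - u))
      (hg.1.comp_quasiMeasurePreserving
        (quasiMeasurePreserving_sub_left_of_right_invariant volume t))
  have hn : eLpNorm (fun p : ℝ × ℝ => g (t - p.1)) 2
      (volume.restrict (Set.univ ×ˢ Set.Icc (-R) R)) =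
        volume (Set.Icc (-R) R) ^ (1 / 2 : ℝ) := by
    have hsq : ∫⁻ p in Set.univ ×ˢ Set.Icc (-R) R, ‖g (t - (p : ℝ × ℝ).1)‖ₑ ^ 2 =
        volume (Set.Icc (-R) R) := by
      have hm := hgt.restrict (s := Set.univ ×ˢ Set.Icc (-R) R)
      rw [volume_eq_prod_restrict_strip] at hm ⊢
      rw [lintegral_prod _ (hm.enorm.pow_const 2)]
      simp only [lintegral_const, Measure.restrict_apply_univ]
      rw [lintegral_mul_const' _ _ (by simp), lintegral_sub_left_eq_self (fun u => ‖g u‖ₑ ^ 2) t,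
        hg1, one_mul]
    rw [← hsq, ← eLpNorm_two_sq, ← ENNReal.rpow_natCast, ← ENNReal.rpow_mul]
    norm_num
  rw [← hn]
  simp only [synthesisNorm, enorm_mul_atom]
  -- Cauchy–Schwarz on the strip: g(t-u) does not depend on ξ, so its squared norm there is the
  -- length of the frequency interval, whatever t is.
  refine (lintegral_enorm_mul_enorm_le (aestronglyMeasurable_qstft hf.1 hg.1).restrict
    hgt.restrict).trans ?_
  gcongr
  exact Measure.restrict_le_self

theorem synthesisNorm_strip_lt_top (hf : MemLp f 2) (hg : MemLp g 2)
    (hg1 : ∫⁻ t, ‖g t‖ₑ ^ 2 = 1) (R t : ℝ) :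
    synthesisNorm g f (Set.univ ×ˢ Set.Icc (-R) R) t < ⊤ := by
  refine (synthesisNorm_strip_le hf hg hg1 R t).trans_lt (ENNReal.mul_lt_top ?_ ?_)
  · exact (memLp_qstft hf hg hg1).2
  · exact ENNReal.rpow_lt_top_of_nonneg (by norm_num) (by simp)

/-- The strip bound is uniform in t, so h ∈ L¹ is what matters here. -/
theorem lintegral_enorm_mul_synthesisNorm_strip_lt_top (hf : MemLp f 2) (hg : MemLp g 2)
    (hg1 : ∫⁻ t, ‖g t‖ₑ ^ 2 = 1) (R : ℝ) (hh : MemLp h 1) :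
    ∫⁻ t, ‖h t‖ₑ * synthesisNorm g f (Set.univ ×ˢ Set.Icc (-R) R) t < ⊤ := by
  refine (lintegral_mono fun t =>
    mul_le_mul_right (synthesisNorm_strip_le hf hg hg1 R t) _).trans_lt ?_
  rw [lintegral_mul_const'' _ hh.1.enorm]
  refine ENNReal.mul_lt_top (memLp_one_iff_integrable.1 hh).2 (ENNReal.mul_lt_top ?_ ?_)
  · exact (memLp_qstft hf hg hg1).2
  · exact ENNReal.rpow_lt_top_of_nonneg (by norm_num) (by simp)

theorem integral_intervalIntegral_eq_synthesis (hf : MemLp f 2) (hg : MemLp g 2)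
    (hg1 : ∫⁻ t, ‖g t‖ₑ ^ 2 = 1) {R : ℝ} (hR : 0 ≤ R) (t : ℝ) :
    ∫ u : ℝ, ∫ ξ in (-R)..R, qstft g f u ξ * atom g u ξ t =
      synthesis g f (Set.univ ×ˢ Set.Icc (-R) R) t := by
  have hi := integrableOn_of_synthesisNorm_lt_top hf.1 hg.1
    (synthesisNorm_strip_lt_top hf hg hg1 R t)
  rw [IntegrableOn, volume_eq_prod_restrict_strip] at hi
  rw [synthesis, volume_eq_prod_restrict_strip, integral_prod _ hi]
  simp only [intervalIntegral.integral_of_le (neg_le_self hR), integral_Icc_eq_integral_Ioc]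

theorem aecover_strip :
    AECover volume atTop fun R : ℝ => (Set.univ : Set ℝ) ×ˢ Set.Icc (-R) R where
  ae_eventually_mem := ae_of_all _ fun p => by
    filter_upwards [eventually_ge_atTop |p.2|] with R hR
    exact ⟨Set.mem_univ _, abs_le.1 hR⟩
  measurableSet := fun _ => MeasurableSet.univ.prod measurableSet_Icc

theorem memLp_integral_intervalIntegral (hf : MemLp f 2) (hg : MemLp g 2)
    (hg1 : ∫⁻ t, ‖g t‖ₑ ^ 2 = 1) (R : ℝ) :
    MemLp (fun t : ℝ => (1 / (2 * π)) •
      ∫ u : ℝ, ∫ ξ in (-R)..R, qstft g f u ξ * atom g u ξ t) 2 volume := by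
  have hpos : ∀ R : ℝ, 0 ≤ R → MemLp (fun t : ℝ => (1 / (2 * π)) •
      ∫ u : ℝ, ∫ ξ in (-R)..R, qstft g f u ξ * atom g u ξ t) 2 volume := fun R hR => by
    simp only [integral_intervalIntegral_eq_synthesis hf hg hg1 hR]
    exact memLp_smul_synthesis hf hg hg1 (MeasurableSet.univ.prod measurableSet_Icc)
      (ae_of_all _ (synthesisNorm_strip_lt_top hf hg hg1 R))
      fun h h1 _ => lintegral_enorm_mul_synthesisNorm_strip_lt_top hf hg hg1 R h1
  rcases le_total 0 R with hR | hR
  · exact hpos R hR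
  -- For R ≤ 0 the oriented integral is the negative of the one for -R.
  · refine (hpos (-R) (neg_nonneg.2 hR)).neg.ae_eq (ae_of_all _ fun t => ?_)
    simp only [Pi.neg_apply, neg_neg, intervalIntegral.integral_symm R (-R), integral_neg, smul_neg]

theorem ae_eq_integral_of_integrable (hf : MemLp f 2) (hg : MemLp g 2)
    (hg1 : ∫⁻ t, ‖g t‖ₑ ^ 2 = 1) :
    ∀ᵐ t : ℝ, Integrable (fun p : ℝ × ℝ => qstft g f p.1 p.2 * atom g p.1 p.2 t) →
      f t = (1 / (2 * π)) • ∫ u : ℝ, ∫ ξ : ℝ, qstft g f u ξ * atom g u ξ t := by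
  have hcov : AECover (volume : Measure (ℝ × ℝ)) atTop
      fun n : ℕ => Metric.closedBall (0 : ℝ × ℝ) n :=
    aecover_closedBall tendsto_natCast_atTop_atTop
  have hfin : ∀ n : ℕ, volume (Metric.closedBall (0 : ℝ × ℝ) n) < ⊤ := fun n =>
    measure_closedBall_lt_top
  have hlim := tendsto_eLpNorm_sub_synthesis hf hg hg1 hcov
    (fun n => ae_synthesisNorm_lt_top hf hg hg1 (hfin n))
    fun n h _ h2 => lintegral_enorm_mul_synthesisNorm_lt_top hf hg hg1 (hfin n) h2
  have hmeas := tendstoInMeasure_of_tendsto_eLpNorm (μ := volume) (p := 2) (l := atTop)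
    (f := fun n : ℕ => fun t =>
      (1 / (2 * π)) • synthesis g f (Metric.closedBall (0 : ℝ × ℝ) n) t) (g := f) two_ne_zero
    (fun n => (aestronglyMeasurable_synthesis hf.1 hg.1 _).const_smul (1 / (2 * π))) hf.1
    (hlim.congr fun n => eLpNorm_sub_comm f _ _ _)
  obtain ⟨ns, hns, hae⟩ := hmeas.exists_seq_tendsto_ae
  filter_upwards [hae] with t ht hi
  -- At such t the superpositions over balls have two limits along the subsequence: f(t), by L²
  -- convergence, and the full integral, by dominated convergence.
  refine tendsto_nhds_unique ht ?_
  have h1 := (hcov.integral_tendsto_of_countably_generated hi).comp hns.tendsto_atTop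
  rw [Measure.volume_eq_prod, integral_prod _ hi] at h1
  exact h1.const_smul (1 / (2 * π))

end Regions

end QSTFT

theorem theorem2
    (f : ℝ → ℍ) (hf : MemLp f 2 volume)
    (g : ℝ → ℝ) (hg : MemLp g 2 volume)
    (hsymm : ∀ᵐ t : ℝ, g (-t) = g t) (hnorm : ∫ t, g t ^ 2 = 1) :
    -- the transform is given by absolutely convergent integrals
    (∀ u ξ : ℝ, Integrable (fun t : ℝ => f t * (g (t - u) : ℍ) * QSTFT.expJ (-(ξ * t)))) ∧
    -- inversion formula: the integral over any exhaustion of the plane by sets of finite area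
    (∀ K : ℕ → Set (ℝ × ℝ), AECover volume atTop K → (∀ n, volume (K n) < ⊤) →
      (∀ n, ∀ᵐ t : ℝ, IntegrableOn
        (fun p : ℝ × ℝ => QSTFT.qstft g f p.1 p.2 * QSTFT.atom g p.1 p.2 t) (K n)) ∧
      (∀ n, MemLp (fun t : ℝ => (1 / (2 * π)) •
        ∫ p in K n, QSTFT.qstft g f p.1 p.2 * QSTFT.atom g p.1 p.2 t) 2 volume) ∧
      Tendsto (fun n => eLpNorm (fun t : ℝ => f t - (1 / (2 * π)) •
        ∫ p in K n, QSTFT.qstft g f p.1 p.2 * QSTFT.atom g p.1 p.2 t) 2 volume)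
        atTop (𝓝 0)) ∧
    -- inversion formula: the iterated integral, improper in the frequency
    ((∀ R t : ℝ, IntegrableOn
        (fun p : ℝ × ℝ => QSTFT.qstft g f p.1 p.2 * QSTFT.atom g p.1 p.2 t)
        (Set.univ ×ˢ Set.Icc (-R) R)) ∧
      (∀ R : ℝ, MemLp (fun t : ℝ => (1 / (2 * π)) •
        ∫ u : ℝ, ∫ ξ in (-R)..R, QSTFT.qstft g f u ξ * QSTFT.atom g u ξ t) 2 volume) ∧
      Tendsto (fun R : ℝ => eLpNorm (fun t : ℝ => f t - (1 / (2 * π)) •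
        ∫ u : ℝ, ∫ ξ in (-R)..R, QSTFT.qstft g f u ξ * QSTFT.atom g u ξ t) 2 volume)
        atTop (𝓝 0)) ∧
    -- inversion formula: pointwise, wherever the double integral converges absolutely
    (∀ᵐ t : ℝ, Integrable
        (fun p : ℝ × ℝ => QSTFT.qstft g f p.1 p.2 * QSTFT.atom g p.1 p.2 t) →
      f t = (1 / (2 * π)) •
        ∫ u : ℝ, ∫ ξ : ℝ, QSTFT.qstft g f u ξ * QSTFT.atom g u ξ t) ∧
    -- conservation of energy
    (Integrable (fun p : ℝ × ℝ => ‖QSTFT.qstft g f p.1 p.2‖ ^ 2) ∧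
      ∫ t, ‖f t‖ ^ 2 = (1 / (2 * π)) * ∫ ξ : ℝ, ∫ u : ℝ, ‖QSTFT.qstft g f u ξ‖ ^ 2) ∧
    -- conservation of the polarization properties
    (Integrable (fun t : ℝ => f t * QSTFT.involJ (f t)) ∧
      Integrable (fun p : ℝ × ℝ =>
        QSTFT.qstft g f p.1 p.2 * QSTFT.involJ (QSTFT.qstft g f p.1 p.2)) ∧
      ∫ t, f t * QSTFT.involJ (f t) = (1 / (2 * π)) •
        ∫ ξ : ℝ, ∫ u : ℝ, QSTFT.qstft g f u ξ * QSTFT.involJ (QSTFT.qstft g f u ξ)) := by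
  have hg1 := QSTFT.lintegral_enorm_sq_eq_one hg hnorm
  have hS := QSTFT.memLp_qstft hf hg hg1
  have hpi : (1 / (2 * π)) * (2 * π) = 1 := one_div_mul_cancel (by positivity)
  refine ⟨QSTFT.integrable_qstft_integrand hf hg, fun K hK hKfin => ⟨fun n => ?_, fun n => ?_, ?_⟩,
    ⟨fun R t => ?_, QSTFT.memLp_integral_intervalIntegral hf hg hg1, ?_⟩,
    QSTFT.ae_eq_integral_of_integrable hf hg hg1, ⟨hS.integrable_norm_pow (by norm_num), ?_⟩,
    QSTFT.integrable_mul_involJ hf, QSTFT.integrable_mul_involJ hS, ?_⟩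
  · filter_upwards [QSTFT.ae_synthesisNorm_lt_top hf hg hg1 (hKfin n)] with t ht
    exact QSTFT.integrableOn_of_synthesisNorm_lt_top hf.1 hg.1 ht
  · exact QSTFT.memLp_smul_synthesis hf hg hg1 (hK.measurableSet n)
      (QSTFT.ae_synthesisNorm_lt_top hf hg hg1 (hKfin n))
      fun h _ h2 => QSTFT.lintegral_enorm_mul_synthesisNorm_lt_top hf hg hg1 (hKfin n) h2
  · exact QSTFT.tendsto_eLpNorm_sub_synthesis hf hg hg1 hK
      (fun n => QSTFT.ae_synthesisNorm_lt_top hf hg hg1 (hKfin n))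
      fun n h _ h2 => QSTFT.lintegral_enorm_mul_synthesisNorm_lt_top hf hg hg1 (hKfin n) h2
  · exact QSTFT.integrableOn_of_synthesisNorm_lt_top hf.1 hg.1
      (QSTFT.synthesisNorm_strip_lt_top hf hg hg1 R t)
  · refine (QSTFT.tendsto_eLpNorm_sub_synthesis hf hg hg1 QSTFT.aecover_strip
      (fun R => ae_of_all _ (QSTFT.synthesisNorm_strip_lt_top hf hg hg1 R))
      fun R h h1 _ =>
        QSTFT.lintegral_enorm_mul_synthesisNorm_strip_lt_top hf hg hg1 R h1).congr' ?_
    filter_upwards [eventually_ge_atTop 0] with R hR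
    simp only [QSTFT.integral_intervalIntegral_eq_synthesis hf hg hg1 hR]
  · rw [← integral_prod_symm (fun p : ℝ × ℝ => ‖QSTFT.qstft g f p.1 p.2‖ ^ 2)
      (hS.integrable_norm_pow (by norm_num)), ← Measure.volume_eq_prod,
      QSTFT.integral_norm_qstft_sq hf hg hg1, ← mul_assoc, hpi, one_mul]
  · rw [← integral_prod_symm (fun p : ℝ × ℝ =>
        QSTFT.qstft g f p.1 p.2 * QSTFT.involJ (QSTFT.qstft g f p.1 p.2))
      (QSTFT.integrable_mul_involJ hS), ← Measure.volume_eq_prod,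
      QSTFT.integral_qstft_mul_involJ hf hg hg1, smul_smul, hpi, one_smul]
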